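/- Let $G=(V,E)$ be a finite tree and let $\Delta^{*}(u,v)$ be the graph distance of $G$. Call a two-element subset $\{u,v\}\subset V$ a couple; it is labelled similar ($y^{*}=+1$) if $\Delta^{*}(u,v)<\theta:=1.5$ (i.e. $\{u,v\}\in E$) and dissimilar ($y^{*}=-1$) if $\Delta^{*}(u,v)>\theta$. Let $s:\mathbb{R}_{\ge 0}\to\mathbb{R}$ be non-decreasing, convex and not constant (for example $s(x)=x^{\gamma}$ with $\gamma\ge 1$). For a space $Z$ with distance function $d_Z$, a threshold $\theta_Z$ and a map $\varphi:V\to Z$, the couple $\{u,v\}$ satisfies the margin condition if $$y^{*}(\{u,v\})=+1\Rightarrow s(d_Z(\varphi(u),\varphi(v)))\le s(\theta_Z)-1,\qquad y^{*}(\{u,v\})=-1\Rightarrow s(d_Z(\varphi(u),\varphi(v)))\ge s(\theta_Z)+1 .$$ Let $v_{\min}(Z)$ be the minimum, over all maps $\varphi:V\to Z$, of the number of couples that violate the margin condition. Let $\mathcal{B}[R;\mathbb{H}^{n}]$ be the closed ball of radius $R$ in the $n$-dimensional hyperbolic space of curvature $-1$, with the hyperbolic distance. Then there exist a radius $R\in\mathbb{R}_{\ge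 0}$ and a threshold $\theta_Z\in[0,2R]$, both independent of $n$, such that $v_{\min}(\mathcal{B}[R;\mathbb{H}^{n}])=0$ for every dimension $n\ge 2$. -/

import Mathlib

open scoped NNReal

noncomputable section

/-- The `n`-dimensional hyperbolic space of curvature `-1`, as the upper sheet
`{(x₀, x) ∈ ℝ × ℝⁿ | x₀ ² - ‖x‖ ² = 1, x₀ > 0}` of the hyperboloid. -/
def HypSpace (n : ℕ) : Type :=
  {x : ℝ × EuclideanSpace ℝ (Fin n) // 0 < x.1 ∧ x.1 ^ 2 - ‖x.2‖ ^ 2 = 1}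

namespace HypSpace

/-- The hyperbolic distance `arcosh (x₀ y₀ - ⟨x, y⟩)`. -/
def hdist {n : ℕ} (x y : HypSpace n) : ℝ :=
  Real.arcosh (x.1.1 * y.1.1 - inner ℝ x.1.2 y.1.2)

/-- The base point `(1, 0)` of the hyperboloid. -/
def origin (n : ℕ) : HypSpace n := ⟨(1, 0), by norm_num⟩

/-- The closed ball of radius `R` in `n`-dimensional hyperbolic space, centred at the base point. -/
def Ball (n : ℕ) (R : ℝ≥0) : Type := {x : HypSpace n // hdist x (origin n) ≤ R}

/-- The distance function of the closed ball, restricted from hyperbolic space. -/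
def ballDist (n : ℕ) (R : ℝ≥0) (x y : Ball n R) : ℝ := hdist x.1 y.1

instance (n : ℕ) (R : ℝ≥0) : Nonempty (Ball n R) :=
  ⟨⟨origin n, by simp [hdist, origin]⟩⟩

end HypSpace

/-- The true label of the couple `{u, v}` for the dissimilarity `dsim` and the threshold `θ`:
`+1` if `u` and `v` are similar (`dsim u v < θ`) and `-1` if they are dissimilar
(`dsim u v > θ`). -/
def trueLabel {V : Type*} (dsim : V → V → ℝ) (θ : ℝ) (u v : V) : SignType :=
  SignType.sign (θ - dsim u v)

/-- The margin condition for the couple `c` (a two-element set): similar entities are represented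
at distance `d` with `s d ≤ s θZ - 1`, dissimilar ones with `s d ≥ s θZ + 1`. -/
def MarginCondition {V Z : Type*} (dsim : V → V → ℝ) (θ : ℝ) (dZ : Z → Z → ℝ) (s : ℝ → ℝ)
    (θZ : ℝ) (φ : V → Z) (c : Finset V) : Prop :=
  ∀ u ∈ c, ∀ v ∈ c, u ≠ v →
    (trueLabel dsim θ u v = 1 → s (dZ (φ u) (φ v)) ≤ s θZ - 1) ∧
    (trueLabel dsim θ u v = -1 → s (dZ (φ u) (φ v)) ≥ s θZ + 1)

open Classical in
/-- The number of couples that violate the margin condition under the representation map `φ`. -/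
def violations {V Z : Type*} [Fintype V] (dsim : V → V → ℝ) (θ : ℝ) (dZ : Z → Z → ℝ)
    (s : ℝ → ℝ) (θZ : ℝ) (φ : V → Z) : ℕ :=
  ((Finset.powersetCard 2 (Finset.univ : Finset V)).filter
    fun c => ¬ MarginCondition dsim θ dZ s θZ φ c).card

/-- The minimum number of violated couples over all representation maps `V → Z`. -/
def vMin {V : Type*} [Fintype V] (dsim : V → V → ℝ) (θ : ℝ) (Z : Type*) [Nonempty Z]
    (dZ : Z → Z → ℝ) (s : ℝ → ℝ) (θZ : ℝ) : ℕ :=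
  sInf (Set.range fun φ : V → Z => violations dsim θ dZ s θZ φ)

/-- The dissimilarity given by the graph distance. -/
def graphDsim {V : Type*} (G : SimpleGraph V) (u v : V) : ℝ := (G.dist u v : ℝ)

end

/-
Root the tree at a vertex and place it in the upper half-plane: with `t = exp (-L)`, a vertex of
depth `n` sits at height `t ^ n` and is shifted horizontally from its parent by a bounded multiple
of `t ^ (n - 1)`, the multiples being distinct for siblings. An edge then has length `L + O(1)`.
Two non-adjacent vertices are at distance at least `2 * L`: either their depths differ by at least
two, or both lie at depth greater than `k` while their abscissae differ by at least `t ^ k`, where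
`k` is the depth at which they branch. Hence the gap between the two kinds of couples exceeds any
prescribed bound when `L` is large, and a convex, non-decreasing, non-constant `s` eventually grows
at least linearly, so that it turns a large enough gap into the required margins.
-/

open Filter Set
open scoped UpperHalfPlane

section ConvexGrowth

variable {s : ℝ → ℝ} {D : Set ℝ} {x y z w : ℝ}

lemma add_slope_mul_le_of_convexOn (hs : ConvexOn ℝ D s) (hx : x ∈ D) (hy : y ∈ D) (hz : z ∈ D)
    (hw : w ∈ D) (hxy : x < y) (hyz : y ≤ z) (hzw : z < w) :
    s z + (s y - s x) / (y - x) * (w - z) ≤ s w := by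
  have hxz : x < z := hxy.trans_le hyz
  have hslope : (s y - s x) / (y - x) ≤ (s w - s z) / (w - z) :=
    (hs.secant_mono hx hy hz hxy.ne' hxz.ne' hyz).trans (hs.slope_mono_adjacent hx hw hxz hzw)
  linarith [(le_div_iff₀ (sub_pos.2 hzw)).1 hslope]

lemma exists_lt_map_lt_of_monotoneOn (hs : MonotoneOn s D)
    (hne : ∃ x ∈ D, ∃ y ∈ D, s x ≠ s y) : ∃ x ∈ D, ∃ y ∈ D, x < y ∧ s x < s y := by
  obtain ⟨x, hx, y, hy, hxy⟩ := hne
  rcases hxy.lt_or_gt with h | h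
  · exact ⟨x, hx, y, hy, hs.reflect_lt hx hy h, h⟩
  · exact ⟨y, hy, x, hx, hs.reflect_lt hy hx h, h⟩

lemma exists_eventually_add_one_le_of_convexOn {a : ℝ} (hmono : MonotoneOn s (Ici a))
    (hconv : ConvexOn ℝ (Ici a) s) (hne : ∃ x ∈ Ici a, ∃ y ∈ Ici a, s x ≠ s y) :
    ∃ M > 0, ∀ᶠ z in atTop, s z + 1 ≤ s (z + M) := by
  obtain ⟨x, hx, y, hy, hxy, hs⟩ := exists_lt_map_lt_of_monotoneOn hmono hne
  have hdx : 0 < y - x := sub_pos.2 hxy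
  have hds : 0 < s y - s x := sub_pos.2 hs
  have hM : 0 < (y - x) / (s y - s x) := div_pos hdx hds
  refine ⟨_, hM, (eventually_ge_atTop y).mono fun z hz => ?_⟩
  have haz : a ≤ z := le_trans hy hz
  have hgrow := add_slope_mul_le_of_convexOn hconv hx hy haz
    (mem_Ici.2 (haz.trans (le_add_of_nonneg_right hM.le))) hxy hz (lt_add_of_pos_right z hM)
  rwa [add_sub_cancel_left, div_mul_div_cancel₀ hdx.ne', div_self hds.ne'] at hgrow

end ConvexGrowth

section RootedTree

variable {V : Type*} {G : SimpleGraph V} {r v : V}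

lemma exists_adj_dist_eq_add_one (hG : G.Connected) (hv : v ≠ r) :
    ∃ u, G.Adj u v ∧ G.dist r v = G.dist r u + 1 := by
  obtain ⟨p, hp⟩ := hG.exists_walk_length_eq_dist r v
  have hnil : ¬ p.Nil := fun h => hv h.eq.symm
  have hadj : G.Adj p.penultimate v := p.adj_penultimate hnil
  have hle : G.dist r p.penultimate ≤ p.dropLast.length := G.dist_le p.dropLast
  have hlen : p.dropLast.length + 1 = p.length := p.length_dropLast_add_one hnil
  have htri : G.dist r v ≤ G.dist r p.penultimate + G.dist p.penultimate v := hG.dist_triangle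
  rw [SimpleGraph.dist_eq_one_iff_adj.2 hadj] at htri
  exact ⟨p.penultimate, hadj, by omega⟩

lemma eq_of_adj_of_dist_eq_add_one (hG : G.IsTree) {a b : V} (ha : G.Adj a v) (hb : G.Adj b v)
    (hav : G.dist r v = G.dist r a + 1) (hbv : G.dist r v = G.dist r b + 1) : a = b := by
  obtain ⟨p, hp⟩ := hG.connected.exists_walk_length_eq_dist r a
  obtain ⟨q, hq⟩ := hG.connected.exists_walk_length_eq_dist r b
  have hpath_p : (p.concat ha).IsPath := SimpleGraph.Walk.isPath_of_length_eq_dist _ <| by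
    rw [SimpleGraph.Walk.length_concat, hp, hav]
  have hpath_q : (q.concat hb).IsPath := SimpleGraph.Walk.isPath_of_length_eq_dist _ <| by
    rw [SimpleGraph.Walk.length_concat, hq, hbv]
  simpa using congrArg SimpleGraph.Walk.penultimate
    ((hG.existsUnique_path r v).unique hpath_p hpath_q)

lemma exists_parent_of_isTree (hG : G.IsTree) (r : V) :
    ∃ par : V → V, ∀ u v, (G.Adj u v ∧ G.dist r v = G.dist r u + 1) ↔ (v ≠ r ∧ par v = u) := by
  have hparent (v : V) : ∃ a, v ≠ r → G.Adj a v ∧ G.dist r v = G.dist r a + 1 := by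
    by_cases hv : v = r
    · exact ⟨v, fun h => absurd hv h⟩
    · exact (exists_adj_dist_eq_add_one hG.connected hv).imp fun _ h _ => h
  choose par hpar using hparent
  refine ⟨par, fun u v => ⟨fun ⟨hadj, hdist⟩ => ?_, ?_⟩⟩
  · have hv : v ≠ r := by
      rintro rfl
      simp at hdist
    obtain ⟨hadj', hdist'⟩ := hpar v hv
    exact ⟨hv, eq_of_adj_of_dist_eq_add_one hG hadj' hadj hdist' hdist⟩
  · rintro ⟨hv, rfl⟩
    exact hpar v hv

lemma iterate_dist_eq_root (hG : G.Connected) {par : V → V}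
    (hpar : ∀ v, v ≠ r → G.dist r v = G.dist r (par v) + 1) (v : V) :
    par^[G.dist r v] v = r := by
  induction h : G.dist r v generalizing v with
  | zero => exact (hG.dist_eq_zero_iff.1 h).symm
  | succ n ih =>
    have hv : v ≠ r := by
      rintro rfl
      simp at h
    exact ih (par v) (Nat.succ_injective ((hpar v hv).symm.trans h))

end RootedTree

section HalfPlane

lemma sq_re_sub_le_im_mul_im_mul_exp_dist (z w : ℍ) :
    (z.re - w.re) ^ 2 ≤ z.im * w.im * Real.exp (dist z w) := by
  have hcosh := UpperHalfPlane.cosh_dist' z w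
  have hpos : 0 < z.im * w.im := mul_pos z.im_pos w.im_pos
  have hexp : Real.exp (-dist z w) ≤ 1 := Real.exp_le_one_iff.2 (neg_nonpos.2 dist_nonneg)
  rw [eq_div_iff (by positivity), Real.cosh_eq] at hcosh
  linarith [mul_le_mul_of_nonneg_left hexp hpos.le, two_mul_le_add_sq z.im w.im]

lemma two_mul_le_dist_of_im_mul_exp_le {z w : ℍ} {L : ℝ}
    (hz : z.im * Real.exp L ≤ |z.re - w.re|) (hw : w.im * Real.exp L ≤ |z.re - w.re|) :
    2 * L ≤ dist z w := by
  have hpos : 0 < z.im * w.im := mul_pos z.im_pos w.im_pos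
  refine Real.exp_le_exp.1 (le_of_mul_le_mul_left ?_ hpos)
  calc z.im * w.im * Real.exp (2 * L)
      = z.im * Real.exp L * (w.im * Real.exp L) := by rw [two_mul, Real.exp_add]; ring
    _ ≤ |z.re - w.re| * |z.re - w.re| := by gcongr
    _ = (z.re - w.re) ^ 2 := by rw [abs_mul_abs_self, sq]
    _ ≤ _ := sq_re_sub_le_im_mul_im_mul_exp_dist z w

end HalfPlane

section Placement

variable {V : Type*} {par : V → V} {label : V → ℝ} {C t L : ℝ} {m n : ℕ} {u v : V}

/-- The horizontal coordinate of a vertex of depth `n` in a rooted tree with parent map `par`: the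
sum of `label w * t ^ k` over the ancestors-or-self `w ≠ root` of the vertex, where `k + 1` is the
depth of `w`. The depth is passed as an argument, so `par` may take any value at the root. -/
def abscissa (par : V → V) (label : V → ℝ) (t : ℝ) : ℕ → V → ℝ
  | 0, _ => 0
  | n + 1, v => abscissa par label t n (par v) + label v * t ^ n

/-- The point of the upper half-plane at which a vertex of depth `n` is placed, for the scale
`t = exp (-L)`; the parameter `L` is the hyperbolic distance between consecutive levels. -/
noncomputable def treePoint (par : V → V) (label : V → ℝ) (L : ℝ) (n : ℕ) (v : V) : ℍ :=
  ⟨⟨abscissa par label (Real.exp (-L)) n v, Real.exp (-L) ^ n⟩, by positivity⟩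

lemma treePoint_re : (treePoint par label L n v).re = abscissa par label (Real.exp (-L)) n v := rfl

lemma treePoint_im : (treePoint par label L n v).im = Real.exp (-L) ^ n := rfl

lemma log_treePoint_im : Real.log (treePoint par label L n v).im = -(n * L) := by
  rw [treePoint_im, Real.log_pow, Real.log_exp, mul_neg]

lemma exists_pow_add_le_abs_abscissa_sub (hlabel : ∀ v, label v ∈ Icc 0 C)
    (hsib : ∀ u v, u ≠ v → par u = par v → 2 ≤ |label u - label v|)
    (ht : 0 ≤ t) (ht2 : t ≤ 1 / 2) (hCt : 2 * C * t ≤ 1) (huv : u ≠ v)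
    (hanc : par^[n] u = par^[n] v) :
    ∃ k < n, t ^ k + 2 * C * t ^ n ≤ |abscissa par label t n u - abscissa par label t n v| := by
  induction n generalizing u v with
  | zero => exact absurd hanc huv
  | succ n ih =>
    have htn : 0 ≤ t ^ n := pow_nonneg ht n
    by_cases hp : par u = par v
    · refine ⟨n, n.lt_succ_self, ?_⟩
      calc t ^ n + 2 * C * t ^ (n + 1) = (1 + 2 * C * t) * t ^ n := by ring
        _ ≤ |label u - label v| * t ^ n := by gcongr; linarith [hsib u v huv hp]
        _ = |(label u - label v) * t ^ n| := by rw [abs_mul, abs_of_nonneg htn]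
        _ = _ := by simp only [abscissa, hp]; ring_nf
    · obtain ⟨k, hk, hsep⟩ := ih hp hanc
      refine ⟨k, hk.trans n.lt_succ_self, ?_⟩
      have hC : 0 ≤ C := (hlabel u).1.trans (hlabel u).2
      have hdrift : |(label v - label u) * t ^ n| ≤ C * t ^ n := by
        rw [abs_mul, abs_of_nonneg htn]
        gcongr
        exact abs_sub_le_of_nonneg_of_le (hlabel v).1 (hlabel v).2 (hlabel u).1 (hlabel u).2
      have hpow : 2 * C * t ^ (n + 1) ≤ C * t ^ n := by
        rw [pow_succ]
        nlinarith [mul_le_mul_of_nonneg_left ht2 (mul_nonneg hC htn)]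
      calc t ^ k + 2 * C * t ^ (n + 1)
          ≤ |abscissa par label t n (par u) - abscissa par label t n (par v)|
              - |(label v - label u) * t ^ n| := by linarith
        _ ≤ |abscissa par label t n (par u) - abscissa par label t n (par v)
              - (label v - label u) * t ^ n| := abs_sub_abs_le_abs_sub _ _
        _ = _ := by simp only [abscissa]; ring_nf

lemma dist_treePoint_parent_le (hL : 0 ≤ L) (hlabel : |label v| ≤ C) :
    dist (treePoint par label L (n + 1) v) (treePoint par label L n (par v)) ≤ L + C := by
  let w : ℍ := ⟨⟨(treePoint par label L (n + 1) v).re, Real.exp (-L) ^ n⟩, by positivity⟩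
  have hvert : dist (treePoint par label L (n + 1) v) w = L := by
    have hw : Real.log w.im = -(n * L) := log_treePoint_im (par := par) (label := label) (v := v)
    have hre : (treePoint par label L (n + 1) v).re = w.re := rfl
    have hlevel : -(n * L) - -((n + 1 : ℕ) * L) = L := by push_cast; ring
    rw [UpperHalfPlane.dist_of_re_eq hre, log_treePoint_im, hw, Real.dist_eq, abs_sub_comm, hlevel,
      abs_of_nonneg hL]
  have hhor : dist w (treePoint par label L n (par v)) ≤ C := by
    have him : w.im = (treePoint par label L n (par v)).im := rfl
    have hre : w.re - (treePoint par label L n (par v)).re = label v * Real.exp (-L) ^ n :=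
      add_sub_cancel_left _ _
    refine (UpperHalfPlane.dist_le_dist_coe_div_sqrt _ _).trans ?_
    rw [Complex.dist_of_im_eq him, UpperHalfPlane.coe_re, UpperHalfPlane.coe_re, Real.dist_eq, hre,
      him, Real.sqrt_mul_self (UpperHalfPlane.im_pos _).le, treePoint_im, abs_mul,
      abs_of_nonneg (by positivity : 0 ≤ Real.exp (-L) ^ n),
      mul_div_cancel_right₀ _ (by positivity)]
    exact hlabel
  linarith [dist_triangle (treePoint par label L (n + 1) v) w (treePoint par label L n (par v))]

lemma two_mul_le_dist_treePoint_of_add_two_le (hL : 0 ≤ L) (hmn : m + 2 ≤ n) :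
    2 * L ≤ dist (treePoint par label L m u) (treePoint par label L n v) := by
  refine le_trans ?_ (UpperHalfPlane.dist_log_im_le _ _)
  have hmn' : (m : ℝ) + 2 ≤ n := by exact_mod_cast hmn
  rw [log_treePoint_im, log_treePoint_im, Real.dist_eq]
  refine le_trans ?_ (le_abs_self _)
  linarith [mul_le_mul_of_nonneg_right hmn' hL]

lemma two_mul_le_dist_treePoint_of_pow_le {k : ℕ} (hL : 0 ≤ L) (hkm : k < m) (hkn : k < n)
    (h : Real.exp (-L) ^ k ≤
      |abscissa par label (Real.exp (-L)) m u - abscissa par label (Real.exp (-L)) n v|) :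
    2 * L ≤ dist (treePoint par label L m u) (treePoint par label L n v) := by
  have him {j : ℕ} (hj : k < j) : Real.exp (-L) ^ j * Real.exp L ≤ Real.exp (-L) ^ k :=
    calc Real.exp (-L) ^ j * Real.exp L ≤ Real.exp (-L) ^ (k + 1) * Real.exp L := by
          gcongr ?_ * _
          exact pow_le_pow_of_le_one (Real.exp_pos _).le (Real.exp_le_one_iff.2 (by linarith)) hj
      _ = Real.exp (-L) ^ k := by rw [pow_succ, mul_assoc, ← Real.exp_add]; simp
  exact two_mul_le_dist_of_im_mul_exp_le ((him hkm).trans h) ((him hkn).trans h)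

lemma two_mul_le_dist_treePoint (hlabel : ∀ v, label v ∈ Icc 0 C)
    (hsib : ∀ u v, u ≠ v → par u = par v → 2 ≤ |label u - label v|) (hL : 0 ≤ L)
    (ht2 : Real.exp (-L) ≤ 1 / 2) (hCt : 2 * C * Real.exp (-L) ≤ 1)
    (hanc : par^[m] u = par^[n] v) (hmn : m ≤ n) (hne : ¬ (n = m ∧ v = u))
    (hpar : ¬ (n = m + 1 ∧ par v = u)) :
    2 * L ≤ dist (treePoint par label L m u) (treePoint par label L n v) := by
  have ht : 0 ≤ Real.exp (-L) := (Real.exp_pos _).le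
  have hC : 0 ≤ C := (hlabel u).1.trans (hlabel u).2
  have hdrift : 0 ≤ C * Real.exp (-L) ^ m := by positivity
  obtain rfl | rfl | hmn : n = m ∨ n = m + 1 ∨ m + 2 ≤ n := by omega
  · have huv : u ≠ v := fun h => hne ⟨rfl, h.symm⟩
    obtain ⟨k, hk, hsep⟩ :=
      exists_pow_add_le_abs_abscissa_sub hlabel hsib ht ht2 hCt huv hanc
    exact two_mul_le_dist_treePoint_of_pow_le hL hk hk (by linarith)
  · have huv : u ≠ par v := fun h => hpar ⟨rfl, h.symm⟩
    obtain ⟨k, hk, hsep⟩ :=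
      exists_pow_add_le_abs_abscissa_sub hlabel hsib ht ht2 hCt huv hanc
    refine two_mul_le_dist_treePoint_of_pow_le hL hk (hk.trans m.lt_succ_self) ?_
    have hshift : |label v * Real.exp (-L) ^ m| ≤ C * Real.exp (-L) ^ m := by
      rw [abs_of_nonneg (mul_nonneg (hlabel v).1 (by positivity))]
      gcongr
      exact (hlabel v).2
    have htri := abs_sub_abs_le_abs_sub (abscissa par label (Real.exp (-L)) m u -
      abscissa par label (Real.exp (-L)) m (par v)) (label v * Real.exp (-L) ^ m)
    rw [abscissa, ← sub_sub]
    linarith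
  · exact two_mul_le_dist_treePoint_of_add_two_le hL hmn

lemma exists_separated_label (V : Type*) [Finite V] :
    ∃ (C : ℝ) (label : V → ℝ), (∀ v, label v ∈ Icc 0 C) ∧
      ∀ u v, u ≠ v → 2 ≤ |label u - label v| := by
  let e := Finite.equivFin V
  refine ⟨2 * Nat.card V, fun v => 2 * (e v : ℕ), fun v => ⟨by positivity, ?_⟩, fun u v huv => ?_⟩
  · exact mul_le_mul_of_nonneg_left (by exact_mod_cast (e v).is_lt.le) zero_le_two
  · have hne : ((e u : ℕ) : ℤ) - (e v : ℕ) ≠ 0 :=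
      sub_ne_zero.2 fun h => huv (e.injective (Fin.ext (by exact_mod_cast h)))
    have habs : (1 : ℝ) ≤ |((e u : ℕ) : ℝ) - (e v : ℕ)| := by
      exact_mod_cast Int.one_le_abs hne
    rw [← mul_sub, abs_mul, abs_two]
    linarith

theorem exists_eventually_halfPlane_embedding {G : SimpleGraph V} [Finite V] (hG : G.IsTree) :
    ∃ C : ℝ, ∀ᶠ L in atTop, ∃ φ : V → ℍ,
      (∀ u v, G.Adj u v → dist (φ u) (φ v) ≤ L + C) ∧
      ∀ u v, u ≠ v → ¬ G.Adj u v → 2 * L ≤ dist (φ u) (φ v) := by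
  obtain ⟨r⟩ := hG.connected.nonempty
  obtain ⟨par, hpar⟩ := exists_parent_of_isTree hG r
  obtain ⟨C, label, hlabel, hsep⟩ := exists_separated_label V
  have hroot : ∀ v, par^[G.dist r v] v = r :=
    iterate_dist_eq_root hG.connected fun v hv => ((hpar (par v) v).2 ⟨hv, rfl⟩).2
  have hexp : Tendsto (fun L : ℝ => Real.exp (-L)) atTop (nhds 0) :=
    Real.tendsto_exp_neg_atTop_nhds_zero
  have hsmall : ∀ᶠ L in atTop, Real.exp (-L) ≤ 1 / 2 :=
    hexp.eventually_le_const (by norm_num)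
  have hCsmall : ∀ᶠ L in atTop, 2 * C * Real.exp (-L) ≤ 1 :=
    (hexp.const_mul (2 * C)).eventually_le_const (by norm_num)
  refine ⟨C, ?_⟩
  filter_upwards [eventually_ge_atTop 0, hsmall, hCsmall] with L hL ht2 hCt
  refine ⟨fun v => treePoint par label L (G.dist r v) v, fun u v huv => ?_, fun u v huv hn => ?_⟩
  · wlog hdist : G.dist r v = G.dist r u + 1 generalizing u v
    · rw [dist_comm]
      exact this v u huv.symm ((hG.dist_eq_dist_add_one_of_adj r huv).resolve_right hdist)
    obtain ⟨-, rfl⟩ := (hpar u v).1 ⟨huv, hdist⟩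
    rw [dist_comm]
    simp only [hdist]
    exact dist_treePoint_parent_le hL ((abs_of_nonneg (hlabel v).1).trans_le (hlabel v).2)
  · wlog hle : G.dist r u ≤ G.dist r v generalizing u v
    · rw [dist_comm]
      exact this v u huv.symm (fun h => hn h.symm) (le_of_not_ge hle)
    refine two_mul_le_dist_treePoint hlabel (fun u v h _ => hsep u v h) hL ht2 hCt
      ((hroot u).trans (hroot v).symm) hle (fun h => huv h.2.symm) fun ⟨hdist, hp⟩ => hn ?_
    have hv : v ≠ r := by
      rintro rfl
      simp at hdist
    exact ((hpar u v).2 ⟨hv, hp⟩).1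

end Placement

lemma HypSpace.exists_isometry_upperHalfPlane {n : ℕ} (hn : 2 ≤ n) :
    ∃ F : ℍ → HypSpace n, (∀ z w, hdist (F z) (F w) = dist z w) ∧
      F UpperHalfPlane.I = origin n := by
  let i : Fin n := ⟨0, by omega⟩
  let j : Fin n := ⟨1, by omega⟩
  have hij : i ≠ j := by simp [i, j]
  let e : ℝ → ℝ → EuclideanSpace ℝ (Fin n) := fun a b =>
    EuclideanSpace.single i a + EuclideanSpace.single j b
  have inner_e (a b a' b' : ℝ) : inner ℝ (e a b) (e a' b') = a * a' + b * b' := by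
    simp [e, inner_add_left, inner_add_right, EuclideanSpace.inner_single_left, hij, hij.symm]
  refine ⟨fun z => ⟨((z.re ^ 2 + z.im ^ 2 + 1) / (2 * z.im),
    e ((z.re ^ 2 + z.im ^ 2 - 1) / (2 * z.im)) (z.re / z.im)), by positivity, ?_⟩,
    fun z w => ?_, ?_⟩
  · rw [← real_inner_self_eq_norm_sq, inner_e]
    field_simp
    ring
  · rw [← Real.arcosh_cosh (dist_nonneg (x := z) (y := w)), UpperHalfPlane.cosh_dist']
    simp only [hdist, inner_e]
    congr 1
    field_simp
    ring
  · have he : e 0 0 = 0 := inner_self_eq_zero.1 ((inner_e 0 0 0 0).trans (by simp))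
    exact Subtype.ext (by simp [origin, he])

lemma HypSpace.eventually_exists_ball_embedding {V : Type*} [Finite V] (φ : V → ℍ) :
    ∀ᶠ R : ℝ≥0 in atTop, ∀ n : ℕ, 2 ≤ n →
      ∃ ψ : V → Ball n R, ∀ u v, ballDist n R (ψ u) (ψ v) = dist (φ u) (φ v) := by
  obtain ⟨ρ, hρ⟩ := Finite.exists_le fun v => (dist (φ v) UpperHalfPlane.I).toNNReal
  filter_upwards [eventually_ge_atTop ρ] with R hR n hn
  obtain ⟨F, hF, hFI⟩ := exists_isometry_upperHalfPlane hn
  have hball (v : V) : hdist (F (φ v)) (origin n) ≤ R := by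
    rw [← hFI, hF]
    exact Real.toNNReal_le_iff_le_coe.1 ((hρ v).trans hR)
  exact ⟨fun v => ⟨F (φ v), hball v⟩, fun u v => hF (φ u) (φ v)⟩

lemma vMin_graphDsim_eq_zero {V : Type*} [Fintype V] {G : SimpleGraph V} (hG : G.Connected)
    {Z : Type*} [Nonempty Z] {dZ : Z → Z → ℝ} {s : ℝ → ℝ} {θZ : ℝ} (φ : V → Z)
    (hadj : ∀ u v, G.Adj u v → s (dZ (φ u) (φ v)) ≤ s θZ - 1)
    (hnadj : ∀ u v, u ≠ v → ¬ G.Adj u v → s θZ + 1 ≤ s (dZ (φ u) (φ v))) :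
    vMin (graphDsim G) (3 / 2) Z dZ s θZ = 0 := by
  refine Nat.le_zero.1 (Nat.sInf_le ⟨φ, ?_⟩)
  simp only [violations, Finset.card_eq_zero, Finset.filter_eq_empty_iff, not_not]
  intro c _ u _ v _ huv
  simp only [trueLabel, graphDsim, sign_eq_one_iff, sign_eq_neg_one_iff, sub_pos, sub_neg]
  refine ⟨fun hlt => hadj u v ?_, fun hgt => hnadj u v huv fun huv' => ?_⟩
  · by_contra huv'
    have hdist : (2 : ℝ) ≤ G.dist u v := by
      exact_mod_cast hG.one_lt_dist_of_ne_of_not_adj huv huv'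
    linarith
  · rw [SimpleGraph.dist_eq_one_iff_adj.2 huv'] at hgt
    norm_num at hgt

theorem lemma3 {V : Type*} [Fintype V] (G : SimpleGraph V) (hG : G.IsTree)
    (s : ℝ → ℝ) (hs_mono : MonotoneOn s (Set.Ici 0)) (hs_conv : ConvexOn ℝ (Set.Ici 0) s)
    (hs_nonconst : ∃ x ∈ Set.Ici (0 : ℝ), ∃ y ∈ Set.Ici (0 : ℝ), s x ≠ s y) :
    ∃ R : ℝ≥0, ∃ θZ ∈ Set.Icc (0 : ℝ) (2 * R), ∀ n : ℕ, 2 ≤ n →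
      vMin (graphDsim G) (3 / 2) (HypSpace.Ball n R) (HypSpace.ballDist n R) s θZ = 0 := by
  obtain ⟨M, hM, hgrow⟩ := exists_eventually_add_one_le_of_convexOn hs_mono hs_conv hs_nonconst
  obtain ⟨b, hb⟩ := eventually_atTop.1 hgrow
  obtain ⟨C, hC⟩ := exists_eventually_halfPlane_embedding hG
  obtain ⟨L, ⟨φ, hadj, hnadj⟩, hLb, hL0, hLM⟩ := (hC.and ((eventually_ge_atTop (b - C)).and
    ((eventually_ge_atTop (-C)).and (eventually_ge_atTop (C + 2 * M))))).exists
  obtain ⟨R, hR, hLR⟩ := ((HypSpace.eventually_exists_ball_embedding φ).and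
    (eventually_ge_atTop (L + C + M).toNNReal)).exists
  replace hLR : L + C + M ≤ R := Real.toNNReal_le_iff_le_coe.1 hLR
  refine ⟨R, L + C + M, ⟨by linarith, by linarith⟩, fun n hn => ?_⟩
  obtain ⟨ψ, hψ⟩ := hR n hn
  refine vMin_graphDsim_eq_zero hG.connected ψ (fun u v huv => ?_) fun u v huv hn => ?_ <;> rw [hψ]
  · have hnear := hs_mono dist_nonneg (mem_Ici.2 (by linarith)) (hadj u v huv)
    linarith [hb (L + C) (by linarith)]
  · have hgap : L + C + M + M ≤ dist (φ u) (φ v) := by linarith [hnadj u v huv hn]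
    have hfar := hs_mono (mem_Ici.2 (by linarith)) dist_nonneg hgap
    linarith [hb (L + C + M) (by linarith)]
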